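/- Let $0<\alpha<1$ and let $a,b,c\in\mathbb C$ with $ab\neq0$ and $c\neq0,-1,-2,\dots$. Put $f(z)=z\,{}_2F_1(a,b;c;z)$ for $|z|<1$, where ${}_2F_1(a,b;c;z)=\sum_{n\ge0}\frac{(a)_n(b)_n}{(c)_n\,n!}z^n$ is the Gaussian hypergeometric function. Suppose that (i) $p=a+b+1-c$ is a real number; (ii) $ab\neq p$ and $|\arg(ab-p)|<\pi\alpha/2$, where $\arg$ is the principal argument; (iii) for all $s\in(0,+\infty)$ and both signs $\varepsilon=\pm1$, $$G_\varepsilon(s^\alpha)\le\alpha\,(s+s^{-1})\,s^\alpha\,\Re\!\left[(ab-p)\,e^{\varepsilon\pi i(1-\alpha)/2}\right],$$ where $G_\varepsilon(x)=Sx^3+T_\varepsilon x^2+U_\varepsilon x+V$ with $$\begin{aligned} S&=2p\cos\tfrac{\pi\alpha}2,\\ T_\varepsilon&=|a|^2+|b|^2-|c-1|^2-2p-4p\cos^2\tfrac{\pi\alpha}2+4\,\Re[ae^{-\varepsilon i\pi\alpha/2}]\,\Re[be^{-\varepsilon i\pi\alpha/2}],\\ U_\varepsilon&=-2\left(|a|^2+|b|^2-|c-1|^2-3p\right)\cos\tfrac{\pi\alpha}2\\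 &\quad+2\,\Re[ae^{-\varepsilon i\pi\alpha/2}]\left(|b|^2-2\Re b\right)+2\,\Re[be^{-\varepsilon i\pi\alpha/2}]\left(|a|^2-2\Re a\right),\\ V&=|a|^2+|b|^2-|c-1|^2-2p+\left(|a|^2-2\Re a\right)\left(|b|^2-2\Re b\right). \end{aligned}$$ Then $f$ is strongly starlike of order $\alpha$; that is, $f$ is analytic on the unit disk $\mathbb D=\{z\in\mathbb C:|z|<1\}$ with $f(0)=0$ and $f'(0)=1$, and $\left|\arg\dfrac{zf'(z)}{f(z)}\right|<\dfrac{\pi\alpha}2$ for all $z\in\mathbb D$. (The quotient $zf'(z)/f(z)$ is read as $1$ at $z=0$; the claim includes that $f(z)\ne0$ and $f'(z)\neq0$ for $0<|z|<1$.) -/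

import Mathlib

noncomputable section

/-- `f` is strongly starlike of order `α`: `f` is analytic on the unit disk with `f 0 = 0` and
`f' 0 = 1`, and `|arg (z f'(z) / f(z))| < π α / 2` on the disk. The quotient `z f'(z) / f(z)` has
the value `1` at `z = 0` by continuity, so that only the points `z ≠ 0` impose a condition; there
the quotient has to be a finite nonzero number, so that its argument exists. -/
structure IsStronglyStarlike (α : ℝ) (f : ℂ → ℂ) : Prop where
  differentiableOn : DifferentiableOn ℂ f (Metric.ball 0 1)
  map_zero : f 0 = 0
  deriv_zero : deriv f 0 = 1
  ne_zero : ∀ z ∈ Metric.ball (0 : ℂ) 1, z ≠ 0 → f z ≠ 0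
  deriv_ne_zero : ∀ z ∈ Metric.ball (0 : ℂ) 1, z ≠ 0 → deriv f z ≠ 0
  abs_arg_lt : ∀ z ∈ Metric.ball (0 : ℂ) 1, z ≠ 0 →
    |Complex.arg (z * deriv f z / f z)| < Real.pi * α / 2

/-- The shifted Gaussian hypergeometric function `z ↦ z ₂F₁(a, b; c; z)`. -/
def shiftedHypergeometric (a b c : ℂ) (z : ℂ) : ℂ :=
  z * ordinaryHypergeometric a b c z

/-- `Re [u e^{-ε i π α / 2}]`. -/
def rotatedRe (α ε : ℝ) (u : ℂ) : ℝ :=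
  (u * Complex.exp (-(ε * Complex.I * Real.pi * α / 2))).re

/-- The coefficient of `x ^ 3`. -/
def coeffS (α p : ℝ) : ℝ :=
  2 * p * Real.cos (Real.pi * α / 2)

/-- The coefficient of `x ^ 2`. -/
def coeffT (α p ε : ℝ) (a b c : ℂ) : ℝ :=
  ‖a‖ ^ 2 + ‖b‖ ^ 2 - ‖c - 1‖ ^ 2 - 2 * p - 4 * p * Real.cos (Real.pi * α / 2) ^ 2
    + 4 * rotatedRe α ε a * rotatedRe α ε b

/-- The coefficient of `x`. -/
def coeffU (α p ε : ℝ) (a b c : ℂ) : ℝ :=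
  -2 * (‖a‖ ^ 2 + ‖b‖ ^ 2 - ‖c - 1‖ ^ 2 - 3 * p) * Real.cos (Real.pi * α / 2)
    + 2 * rotatedRe α ε a * (‖b‖ ^ 2 - 2 * b.re)
    + 2 * rotatedRe α ε b * (‖a‖ ^ 2 - 2 * a.re)

/-- The constant coefficient. -/
def coeffV (p : ℝ) (a b c : ℂ) : ℝ :=
  ‖a‖ ^ 2 + ‖b‖ ^ 2 - ‖c - 1‖ ^ 2 - 2 * p
    + (‖a‖ ^ 2 - 2 * a.re) * (‖b‖ ^ 2 - 2 * b.re)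

/-- The cubic `G_ε(x) = S x ^ 3 + T_ε x ^ 2 + U_ε x + V`. -/
def cubicG (α p ε : ℝ) (a b c : ℂ) (x : ℝ) : ℝ :=
  coeffS α p * x ^ 3 + coeffT α p ε a b c * x ^ 2 + coeffU α p ε a b c * x + coeffV p a b c

end

/-! Write `f = z F` and `q = z f' / f = 1 + w` with `w = z F' / F`. Dividing Gauss's equation by `F`
gives, with `d = z q'`, the Riccati equation `d + X = z (d + Y)`, where `X = w (w + c - 1)` and `Y =
(w + a) (w + b)`. If `q` leaves the sector `|arg| < π α / 2`, consider an exit point `z₀` of least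
modulus. Nunokawa's lemma (Jack's lemma for the Cayley transform of `q ^ (1 / α)`) gives `q z₀ = s ^
α e^{ε i π α / 2}` and `d = ε i α k q z₀` with `k ≥ (s + s⁻¹) / 2`. On that ray `|Y|² - |X|²` is the
cubic `G_ε (s ^ α)`. Since `Y - X = p q + (a b - p)` with `p` real, the cross term `2 Re (conj d (Y
- X))` is `-2 α k s ^ α R`, where `R = Re [(a b - p) e^{ε π i (1 - α) / 2}] > 0`. Hypothesis (iii)
thus gives `|d + Y| ≤ |d + X|`. As `|z₀| < 1`, the Riccati equation forces `d + X = d + Y = 0`, so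
`X = Y`, contradicting `R > 0`. -/

open Metric Filter Topology

/-! ### Hypergeometric series and Gauss's equation -/

/-- Termwise application of the Euler operator `z d/dz` to a power series on the unit disk. -/
theorem hasSum_euler {A : ℕ → ℂ} {F : ℂ → ℂ} (hF : DifferentiableOn ℂ F (ball 0 1))
    (hA : ∀ z ∈ ball (0 : ℂ) 1, HasSum (fun n => A n * z ^ n) (F z)) {z : ℂ}
    (hz : z ∈ ball (0 : ℂ) 1) : HasSum (fun n : ℕ => n * A n * z ^ n) (z * deriv F z) := by
  have hps : ∀ B : ℕ → ℂ, (∀ z ∈ ball (0 : ℂ) 1, HasSum (fun n => B n * z ^ n) (F z)) →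
      HasFPowerSeriesAt F (FormalMultilinearSeries.ofScalars ℂ B) 0 := by
    intro B hB
    rw [hasFPowerSeriesAt_iff]
    filter_upwards [ball_mem_nhds (0 : ℂ) one_pos] with y hy
    simpa [mul_comm] using hB y hy
  have hcoef : ∀ n, A n = (n.factorial : ℂ)⁻¹ * iteratedDeriv n F 0 := by
    have h2 := hps (fun n => (n.factorial : ℂ)⁻¹ * iteratedDeriv n F 0) (by
      intro y hy
      have := Complex.hasSum_taylorSeries_on_ball hF hy
      simpa [mul_comm, mul_assoc, mul_left_comm] using this)
    have h3 := (hps A hA).eq_formalMultilinearSeries h2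
    exact fun n => congrFun (FormalMultilinearSeries.ofScalars_series_injective ℂ ℂ h3) n
  have hd := (Complex.hasSum_taylorSeries_on_ball (hF.deriv isOpen_ball) hz).mul_left z
  -- The `n = 0` term vanishes; after the shift the factor `z` matches `z * deriv F z`.
  rw [← hasSum_nat_add_iff' 1]
  simp only [Finset.range_one, Finset.sum_singleton, Nat.cast_zero, zero_mul, sub_zero]
  refine hd.congr_fun fun n => ?_
  have hn : (n.factorial : ℂ) ≠ 0 := by exact_mod_cast n.factorial_ne_zero
  have hn1 : (n + 1 : ℂ) ≠ 0 := by exact_mod_cast n.succ_ne_zero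
  rw [hcoef, ← iteratedDeriv_succ', Nat.factorial_succ]
  push_cast
  simp only [smul_eq_mul, sub_zero]
  field_simp
  ring

theorem ordinaryHypergeometricCoefficient_succ {a b c : ℂ} (hc : ∀ n : ℕ, c ≠ -(n : ℂ)) (n : ℕ) :
    (n + 1) * (n + c) * ordinaryHypergeometricCoefficient a b c (n + 1) =
      (n + a) * (n + b) * ordinaryHypergeometricCoefficient a b c n := by
  have hn1 : (n + 1 : ℂ) ≠ 0 := by exact_mod_cast n.succ_ne_zero
  have hcn : c + n ≠ 0 := fun h => hc n (eq_neg_of_add_eq_zero_left h)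
  have hp : (ascPochhammer ℂ n).eval c ≠ 0 := by
    intro h
    obtain ⟨k, -, hk⟩ := (ascPochhammer_eval_eq_zero_iff n c).1 h
    exact hc k (by rw [hk, neg_neg])
  have hf : (n.factorial : ℂ) ≠ 0 := by exact_mod_cast n.factorial_ne_zero
  simp only [ordinaryHypergeometricCoefficient, ascPochhammer_succ_eval, Nat.factorial_succ]
  push_cast
  field_simp
  ring

/-- The radius is 1 unless `a` or `b` is a nonpositive integer, when the series is a polynomial;
hence only an inequality. -/
theorem one_le_radius_ordinaryHypergeometricSeries {a b c : ℂ} (hc : ∀ n : ℕ, c ≠ -(n : ℂ)) :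
    1 ≤ (ordinaryHypergeometricSeries ℂ a b c).radius := by
  by_cases ha : ∃ k : ℕ, a = -(k : ℂ)
  · obtain ⟨k, rfl⟩ := ha
    rw [ordinaryHypergeometric_radius_top_of_neg_nat₁]; exact le_top
  by_cases hb : ∃ k : ℕ, b = -(k : ℂ)
  · obtain ⟨k, rfl⟩ := hb
    rw [ordinaryHypergeometric_radius_top_of_neg_nat₂]; exact le_top
  push Not at ha hb
  refine (ordinaryHypergeometricSeries_radius_eq_one ℂ a b c fun k => ⟨?_, ?_, ?_⟩).ge <;> intro h
  · exact ha k (by rw [h, neg_neg])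
  · exact hb k (by rw [h, neg_neg])
  · exact hc k (by rw [h, neg_neg])

theorem hasSum_ordinaryHypergeometric {a b c : ℂ} (hc : ∀ n : ℕ, c ≠ -(n : ℂ)) {z : ℂ}
    (hz : z ∈ ball (0 : ℂ) 1) :
    HasSum (fun n => ordinaryHypergeometricCoefficient a b c n * z ^ n)
      (ordinaryHypergeometric a b c z) := by
  have h := (ordinaryHypergeometricSeries ℂ a b c).hasSum (x := z) (by
    refine eball_subset_eball (one_le_radius_ordinaryHypergeometricSeries hc) ?_
    rwa [← ENNReal.ofReal_one, eball_ofReal])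
  simp only [ordinaryHypergeometricSeries_apply_eq] at h
  exact h

theorem differentiableOn_ordinaryHypergeometric {a b c : ℂ} (hc : ∀ n : ℕ, c ≠ -(n : ℂ)) :
    DifferentiableOn ℂ (ordinaryHypergeometric a b c : ℂ → ℂ) (ball 0 1) := by
  have h1 := one_le_radius_ordinaryHypergeometricSeries (a := a) (b := b) hc
  have h := (ordinaryHypergeometricSeries ℂ a b c).hasFPowerSeriesOnBall (one_pos.trans_le h1)
  refine h.differentiableOn.mono fun z hz => eball_subset_eball h1 ?_
  rwa [← ENNReal.ofReal_one, eball_ofReal]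

/-- Gauss's differential equation, written with the Euler operator `z d/dz`. -/
theorem ordinaryHypergeometric_euler_equation {a b c : ℂ} (hc : ∀ n : ℕ, c ≠ -(n : ℂ))
    {F G : ℂ → ℂ} (hF : F = ordinaryHypergeometric a b c) (hG : ∀ z, G z = z * deriv F z) {z : ℂ}
    (hz : z ∈ ball (0 : ℂ) 1) :
    z * deriv G z + (c - 1) * G z = z * (z * deriv G z + (a + b) * G z + a * b * F z) := by
  set A := ordinaryHypergeometricCoefficient a b c
  have hFd : DifferentiableOn ℂ F (ball 0 1) := hF ▸ differentiableOn_ordinaryHypergeometric hc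
  have hGd : DifferentiableOn ℂ G (ball 0 1) := by
    rw [funext hG]
    exact differentiableOn_id.mul (hFd.deriv isOpen_ball)
  have hs0 : ∀ z ∈ ball (0 : ℂ) 1, HasSum (fun n => A n * z ^ n) (F z) := fun z hz =>
    hF ▸ hasSum_ordinaryHypergeometric hc hz
  have hs1 : ∀ z ∈ ball (0 : ℂ) 1, HasSum (fun n : ℕ => n * A n * z ^ n) (G z) := fun z hz =>
    hG z ▸ hasSum_euler hFd hs0 hz
  have hs2 := hasSum_euler hGd hs1 hz
  have hl := hs2.add ((hs1 z hz).mul_left (c - 1))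
  have hr := ((hs2.add ((hs1 z hz).mul_left (a + b))).add ((hs0 z hz).mul_left (a * b))).mul_left z
  -- Dropping the zero constant term on the left aligns the powers, and the coefficients agree by
  -- the recurrence.
  rw [← hasSum_nat_add_iff' 1] at hl
  simp only [Finset.range_one, Finset.sum_singleton, Nat.cast_zero, zero_mul, mul_zero, add_zero,
    sub_zero] at hl
  refine hl.unique (hr.congr_fun fun n => ?_)
  have := ordinaryHypergeometricCoefficient_succ (a := a) (b := b) hc n
  push_cast
  linear_combination z ^ (n + 1) * this

/-! ### Boundary lemmas of Jack, Schwarz and Nunokawa -/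

/-- **Jack's lemma**, with the maximum of the modulus replaced by the bound of Schwarz's lemma. -/
theorem jack_lemma {φ : ℂ → ℂ} {z₀ : ℂ} (hd : DifferentiableAt ℂ φ z₀) (h1 : ‖φ z₀‖ = 1)
    (hφ : ∀ z, ‖z‖ < ‖z₀‖ → ‖φ z‖ ≤ ‖z‖ / ‖z₀‖) (hz₀ : z₀ ≠ 0) :
    ∃ m : ℝ, 1 ≤ m ∧ z₀ * deriv φ z₀ = m * φ z₀ := by
  have hpos : 0 < ‖z₀‖ := norm_pos_iff.2 hz₀
  set u : ℂ := starRingEnd ℂ (φ z₀) * (z₀ * deriv φ z₀) with hu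
  -- Along `z₀ exp (t e)`, which enters the disk, `|φ|² ≤ exp (2 t Re e)` with equality at `t = 0`;
  -- compare the right derivatives there.
  have hdir : ∀ e : ℂ, e.re < 0 → (u * e).re ≤ e.re := by
    intro e he
    have hexp : HasDerivAt (fun t : ℝ => z₀ * Complex.exp (t * e)) (z₀ * e) 0 := by
      have h := ((Complex.ofRealCLM.hasDerivAt (x := (0 : ℝ))).mul_const e).cexp.const_mul z₀
      simpa using h
    have hφ1 : HasDerivAt (fun t : ℝ => φ (z₀ * Complex.exp (t * e))) (deriv φ z₀ * (z₀ * e)) 0 := by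
      refine HasDerivAt.comp_of_eq (0 : ℝ) (h := fun t : ℝ => z₀ * Complex.exp (t * e)) hd.hasDerivAt hexp ?_
      simp
    have hsq := hφ1.norm_sq
    have hre : HasDerivAt (fun t : ℝ => Real.exp (2 * (t * e.re))) (2 * e.re) 0 := by
      have h := (((hasDerivAt_id (0 : ℝ)).mul_const e.re).const_mul 2).exp
      simpa using h
    have hsub := hsq.sub hre
    have hle : 2 * inner ℝ (φ (z₀ * Complex.exp (((0 : ℝ) : ℂ) * e))) (deriv φ z₀ * (z₀ * e))
        - 2 * e.re ≤ 0 := by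
      refine le_of_tendsto hsub.tendsto_slope_zero_right ?_
      filter_upwards [self_mem_nhdsWithin] with t ht
      have ht : (0 : ℝ) < t := ht
      have hn : ‖z₀ * Complex.exp (t * e)‖ = ‖z₀‖ * Real.exp (t * e.re) := by
        rw [norm_mul, Complex.norm_exp]; simp
      have hlt : ‖z₀ * Complex.exp (t * e)‖ < ‖z₀‖ := by
        rw [hn]
        exact mul_lt_of_lt_one_right hpos
          (Real.exp_zero ▸ Real.exp_lt_exp.2 (mul_neg_of_pos_of_neg ht he))
      have hb := hφ _ hlt
      rw [hn, mul_div_cancel_left₀ _ hpos.ne'] at hb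
      have hb2 : ‖φ (z₀ * Complex.exp (t * e))‖ ^ 2 ≤ Real.exp (2 * (t * e.re)) := by
        rw [two_mul, Real.exp_add, ← sq]
        exact pow_le_pow_left₀ (norm_nonneg _) hb 2
      simp only [Pi.sub_apply, zero_add, Complex.ofReal_zero, zero_mul, Complex.exp_zero, mul_one,
        h1, mul_zero, Real.exp_zero, one_pow, sub_self, sub_zero, smul_eq_mul]
      exact mul_nonpos_of_nonneg_of_nonpos (inv_nonneg.2 ht.le) (by linarith)
    simp only [Complex.ofReal_zero, zero_mul, Complex.exp_zero, mul_one, Complex.inner] at hle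
    have : u * e = deriv φ z₀ * (z₀ * e) * starRingEnd ℂ (φ z₀) := by rw [hu]; ring
    rw [this]
    linarith
  -- Almost tangential directions `e`, with real part tending to `0`, show that `u` is real;
  -- afterwards `e = -1` gives `u.re ≥ 1`.
  have him : ∀ y : ℝ, -(u.im * y) ≤ 0 := by
    intro y
    refine le_of_forall_pos_le_add fun δ hδ => ?_
    have hk : 0 < |u.re - 1| + 1 := by positivity
    have h := hdir ⟨-(δ / (|u.re - 1| + 1)), y⟩ (by simpa using by positivity)
    simp only [Complex.mul_re] at h
    have h2 : (u.re - 1) * (δ / (|u.re - 1| + 1)) ≤ δ := by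
      rw [mul_div_assoc', div_le_iff₀ hk]
      nlinarith [le_abs_self (u.re - 1)]
    linarith
  have hre : 1 ≤ u.re := by
    have h := hdir (-1) (by simp)
    simp at h
    linarith
  have hu0 : u.im = 0 := by
    have := him 1
    have := him (-1)
    linarith
  refine ⟨u.re, hre, ?_⟩
  have huc : u = (u.re : ℂ) := Complex.ext (by simp) (by simp [hu0])
  have hcc : φ z₀ * starRingEnd ℂ (φ z₀) = 1 := by
    rw [Complex.mul_conj, Complex.normSq_eq_norm_sq, h1]; simp
  rw [← huc, hu]
  linear_combination (-(z₀ * deriv φ z₀)) * hcc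

/-- Schwarz's lemma for functions with positive real part, after the Cayley transform. -/
theorem norm_cayley_le {P : ℂ → ℂ} {r : ℝ} (hP : DifferentiableOn ℂ P (ball 0 r))
    (hre : ∀ z ∈ ball (0 : ℂ) r, 0 < (P z).re) (h0 : P 0 = 1) {z : ℂ} (hz : ‖z‖ < r) :
    ‖(1 - P z) / (1 + P z)‖ ≤ ‖z‖ / r := by
  have hne : ∀ z ∈ ball (0 : ℂ) r, 1 + P z ≠ 0 := by
    intro z hz h
    have := hre z hz
    have h2 := congrArg Complex.re h
    simp at h2
    linarith
  have hmaps : Set.MapsTo (fun z => (1 - P z) / (1 + P z)) (ball 0 r)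
      (closedBall ((fun z => (1 - P z) / (1 + P z)) 0) 1) := by
    intro y hy
    have hy1 := hre y hy
    have hpos : 0 < ‖1 + P y‖ := norm_pos_iff.2 (hne y hy)
    simp only [h0, sub_self, zero_div, mem_closedBall_zero_iff, norm_div]
    rw [div_le_one hpos, ← sq_le_sq₀ (norm_nonneg _) hpos.le, ← Complex.normSq_eq_norm_sq,
      ← Complex.normSq_eq_norm_sq, Complex.normSq_apply, Complex.normSq_apply]
    simp only [Complex.sub_re, Complex.add_re, Complex.sub_im, Complex.add_im, Complex.one_re,
      Complex.one_im]
    nlinarith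
  have h := Complex.dist_le_div_mul_dist_of_mapsTo_ball
    (((differentiableOn_const 1).sub hP).div ((differentiableOn_const 1).add hP) hne) hmaps
    (mem_ball_zero_iff.2 hz)
  rw [one_div_mul_eq_div] at h
  simpa [h0] using h

/-- This describes the sector without `arg`, by functions continuous everywhere; the strict
inequality also excludes `w = 0`. -/
theorem norm_mul_cos_lt_re_iff {β : ℝ} (h0 : 0 ≤ β) (hπ : β ≤ Real.pi) {w : ℂ} (hw : w ≠ 0) :
    ‖w‖ * Real.cos β < w.re ↔ |w.arg| < β := by
  rw [← Complex.norm_mul_cos_arg w, mul_lt_mul_iff_right₀ (norm_pos_iff.2 hw), ← Real.cos_abs w.arg]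
  exact Real.strictAntiOn_cos.lt_iff_gt ⟨h0, hπ⟩ ⟨abs_nonneg _, Complex.abs_arg_le_pi w⟩

theorem abs_arg_eq_of_norm_mul_cos_eq_re {β : ℝ} (h0 : 0 ≤ β) (hπ : β ≤ Real.pi) {w : ℂ}
    (hw : w ≠ 0) (h : ‖w‖ * Real.cos β = w.re) : |w.arg| = β := by
  rw [← Complex.norm_mul_cos_arg w, mul_right_inj' (norm_ne_zero_iff.2 hw), ← Real.cos_abs w.arg] at h
  exact (Real.injOn_cos ⟨h0, hπ⟩ ⟨abs_nonneg _, Complex.abs_arg_le_pi w⟩ h).symm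

theorem norm_exp_log_div {w : ℂ} (hw : w ≠ 0) (α : ℝ) :
    ‖Complex.exp (Complex.log w / α)‖ = ‖w‖ ^ (1 / α) := by
  rw [Complex.norm_exp, Real.rpow_def_of_pos (norm_pos_iff.2 hw), Complex.div_ofReal_re,
    Complex.log_re, mul_one_div]

section Sector

variable {α : ℝ} (hα0 : 0 < α) (hα1 : α < 1)
include hα0 hα1

theorem cos_pi_mul_div_two_pos : 0 < Real.cos (Real.pi * α / 2) := by
  have := Real.pi_pos
  exact Real.cos_pos_of_mem_Ioo ⟨by nlinarith, by nlinarith⟩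

/-- The root `w ^ (1 / α)` opens the sector to the right half-plane, since it divides the argument
by `α`. -/
theorem re_exp_log_div_pos {w : ℂ} (hw : ‖w‖ * Real.cos (Real.pi * α / 2) < w.re) :
    0 < (Complex.exp (Complex.log w / α)).re := by
  have hπ := Real.pi_pos
  have hw0 : w ≠ 0 := by rintro rfl; simp at hw
  have harg := (norm_mul_cos_lt_re_iff (by positivity) (by nlinarith) hw0).1 hw
  rw [Complex.exp_re]
  refine mul_pos (Real.exp_pos _) (Real.cos_pos_of_mem_Ioo ?_)
  rw [Complex.div_ofReal_im, Complex.log_im, Set.mem_Ioo, ← abs_lt, abs_div, abs_of_pos hα0,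
    div_lt_iff₀ hα0]
  linarith

theorem mem_slitPlane_of_norm_mul_cos_le_re {w : ℂ} (hw0 : w ≠ 0)
    (hw : ‖w‖ * Real.cos (Real.pi * α / 2) ≤ w.re) : w ∈ Complex.slitPlane :=
  Or.inl ((mul_pos (norm_pos_iff.2 hw0) (cos_pi_mul_div_two_pos hα0 hα1)).trans_le hw)

theorem norm_cayley_root_le {q : ℂ → ℂ} {r : ℝ} (hq : DifferentiableOn ℂ q (ball 0 r))
    (hsec : ∀ z ∈ ball (0 : ℂ) r, ‖q z‖ * Real.cos (Real.pi * α / 2) < (q z).re) (h0 : q 0 = 1)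
    {z : ℂ} (hz : ‖z‖ < r) :
    ‖(1 - Complex.exp (Complex.log (q z) / α)) / (1 + Complex.exp (Complex.log (q z) / α))‖
      ≤ ‖z‖ / r := by
  refine norm_cayley_le (P := fun z => Complex.exp (Complex.log (q z) / α)) ?_
    (fun z hz => re_exp_log_div_pos hα0 hα1 (hsec z hz)) (by simp [h0]) hz
  refine ((hq.clog fun z hz => ?_).div_const _).cexp
  have hw := hsec z hz
  exact mem_slitPlane_of_norm_mul_cos_le_re hα0 hα1 (by intro h; simp [h] at hw) hw.le

/-- At `z = (1 - 2 x) z₀` Schwarz's bound gives `|q z| ^ (1 / α) ≥ x`, so `|q z| ≥ x ^ α`. A zero at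
`z₀` would give `|q z| = O(x)` by differentiability, impossible as `x → 0` because `α < 1`. -/
theorem ne_zero_of_mapsTo_sector {q : ℂ → ℂ} {z₀ : ℂ} (hz₀ : z₀ ≠ 0)
    (hq : DifferentiableOn ℂ q (ball 0 ‖z₀‖)) (hd : DifferentiableAt ℂ q z₀) (h0 : q 0 = 1)
    (hsec : ∀ z ∈ ball (0 : ℂ) ‖z₀‖, ‖q z‖ * Real.cos (Real.pi * α / 2) < (q z).re) :
    q z₀ ≠ 0 := by
  intro hzero
  have hpos := norm_pos_iff.2 hz₀
  obtain ⟨C, hC⟩ := hd.hasDerivAt.isBigO_sub.bound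
  have hlim : Tendsto (fun x : ℝ => ((1 - 2 * x : ℝ) : ℂ) * z₀) (𝓝[>] 0) (𝓝 z₀) := by
    have : Continuous (fun x : ℝ => ((1 - 2 * x : ℝ) : ℂ) * z₀) := by fun_prop
    simpa using (this.tendsto 0).mono_left nhdsWithin_le_nhds
  have hbig := tendsto_rpow_neg_nhdsGT_zero (y := α - 1) (by linarith)
  have hev := hbig.eventually_gt_atTop (C * (2 * ‖z₀‖))
  have hsmall : ∀ᶠ x : ℝ in 𝓝[>] 0, x < 1 / 2 :=
    nhdsWithin_le_nhds (eventually_lt_nhds (by norm_num))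
  obtain ⟨x, ⟨⟨hx1, hx2⟩, hx3⟩, hx0⟩ :=
    (((hlim.eventually hC).and hev).and hsmall |>.and self_mem_nhdsWithin).exists
  have hx0 : (0 : ℝ) < x := hx0
  set z : ℂ := ((1 - 2 * x : ℝ) : ℂ) * z₀ with hz
  have hnz : ‖z‖ = (1 - 2 * x) * ‖z₀‖ := by
    rw [hz, norm_mul, Complex.norm_of_nonneg (by linarith)]
  have hzlt : ‖z‖ < ‖z₀‖ := by rw [hnz]; nlinarith
  have hw := hsec z (mem_ball_zero_iff.2 hzlt)
  have hw0 : q z ≠ 0 := by intro h; simp [h] at hw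
  have hc := norm_cayley_root_le hα0 hα1 hq hsec h0 hzlt
  set P := Complex.exp (Complex.log (q z) / α) with hP
  have hPre : 0 < P.re := re_exp_log_div_pos hα0 hα1 hw
  have hP1 : 0 < ‖1 + P‖ := norm_pos_iff.2 fun h => by
    have := congrArg Complex.re h
    simp at this
    linarith
  rw [hnz, mul_div_cancel_right₀ _ hpos.ne', norm_div, div_le_iff₀ hP1] at hc
  have hPx : x ≤ ‖P‖ := by
    have h2 := norm_sub_norm_le (1 : ℂ) P
    have h3 := norm_add_le (1 : ℂ) P
    rw [norm_one] at h2 h3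
    nlinarith [norm_nonneg P]
  have hqx : x ^ α ≤ ‖q z‖ := by
    rw [hP, norm_exp_log_div hw0] at hPx
    have := Real.rpow_le_rpow hx0.le hPx hα0.le
    rwa [← Real.rpow_mul (norm_nonneg _), one_div_mul_cancel hα0.ne', Real.rpow_one] at this
  have hzz : ‖z - z₀‖ = 2 * x * ‖z₀‖ := by
    have : z - z₀ = ((-(2 * x) : ℝ) : ℂ) * z₀ := by rw [hz]; push_cast; ring
    rw [this, norm_mul, Complex.norm_real, norm_neg, Real.norm_of_nonneg (by linarith)]
  rw [hzero, sub_zero, hzz] at hx1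
  rw [Real.rpow_sub_one hx0.ne', lt_div_iff₀ hx0] at hx2
  linarith

/-- **Nunokawa's lemma**: the value and the logarithmic derivative at a boundary point of a disk
at which a function, mapping the disk into a sector, first meets the boundary of the sector. -/
theorem exists_of_norm_mul_cos_eq_re {q : ℂ → ℂ} {z₀ : ℂ} (hz₀ : z₀ ≠ 0)
    (hq : DifferentiableOn ℂ q (ball 0 ‖z₀‖)) (hd : DifferentiableAt ℂ q z₀) (h0 : q 0 = 1)
    (hsec : ∀ z ∈ ball (0 : ℂ) ‖z₀‖, ‖q z‖ * Real.cos (Real.pi * α / 2) < (q z).re)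
    (heq : ‖q z₀‖ * Real.cos (Real.pi * α / 2) = (q z₀).re) :
    ∃ ε s k : ℝ, (ε = 1 ∨ ε = -1) ∧ 0 < s ∧ (s + s⁻¹) / 2 ≤ k ∧
      q z₀ = ((s ^ α : ℝ) : ℂ) * Complex.exp (((ε * (Real.pi * α / 2) : ℝ) : ℂ) * Complex.I) ∧
      z₀ * deriv q z₀ = ((ε * α * k : ℝ) : ℂ) * Complex.I * q z₀ := by
  have hπ := Real.pi_pos
  have hq0 : q z₀ ≠ 0 := ne_zero_of_mapsTo_sector hα0 hα1 hz₀ hq hd h0 hsec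
  have habs := abs_arg_eq_of_norm_mul_cos_eq_re (by positivity) (by nlinarith) hq0 heq
  obtain ⟨ε, hε, harg⟩ : ∃ ε : ℝ, (ε = 1 ∨ ε = -1) ∧ (q z₀).arg = ε * (Real.pi * α / 2) := by
    rcases abs_eq (by positivity) |>.1 habs with h | h
    · exact ⟨1, Or.inl rfl, by rw [h]; ring⟩
    · exact ⟨-1, Or.inr rfl, by rw [h]; ring⟩
  set s : ℝ := ‖q z₀‖ ^ (1 / α) with hs
  have hspos : 0 < s := Real.rpow_pos_of_pos (norm_pos_iff.2 hq0) _
  have hsα : s ^ α = ‖q z₀‖ := by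
    rw [hs, ← Real.rpow_mul (norm_nonneg _), one_div_mul_cancel hα0.ne', Real.rpow_one]
  set P : ℂ → ℂ := fun z => Complex.exp (Complex.log (q z) / α) with hP
  have hαC : (α : ℂ) ≠ 0 := by exact_mod_cast hα0.ne'
  have hεI : Complex.exp (((ε * (Real.pi / 2) : ℝ) : ℂ) * Complex.I) = ε * Complex.I := by
    rcases hε with rfl | rfl
    · push_cast
      rw [one_mul, Complex.exp_pi_div_two_mul_I, one_mul]
    · push_cast
      rw [neg_one_mul, ← neg_div, Complex.exp_neg_pi_div_two_mul_I, neg_one_mul]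
  have hP0 : P z₀ = s * (ε * Complex.I) := by
    have hlog : Complex.log (q z₀) / α = ((Real.log ‖q z₀‖ * (1 / α) : ℝ) : ℂ) +
        ((ε * (Real.pi / 2) : ℝ) : ℂ) * Complex.I := by
      rw [Complex.log, harg]
      push_cast
      field_simp
    simp only [hP]
    rw [hlog, Complex.exp_add, hεI, ← Complex.ofReal_exp, hs,
      Real.rpow_def_of_pos (norm_pos_iff.2 hq0)]
  have hε2 : (ε : ℂ) ^ 2 = 1 := by rcases hε with rfl | rfl <;> simp
  have hPd : HasDerivAt P (P z₀ * (deriv q z₀ / q z₀ / α)) z₀ :=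
    ((hd.hasDerivAt.clog (mem_slitPlane_of_norm_mul_cos_le_re hα0 hα1 hq0 heq.le)).div_const _).cexp
  have hsC : (s : ℂ) ≠ 0 := by exact_mod_cast hspos.ne'
  -- `P z₀ = ε i s` is imaginary, so the Cayley transform has modulus 1 at `z₀`, as Jack's lemma
  -- requires.
  have hconj : starRingEnd ℂ (1 + P z₀) = 1 - P z₀ := by
    rw [hP0]
    simp
    ring
  have hne : 1 + P z₀ ≠ 0 := by
    intro h
    have := congrArg Complex.re h
    simp [hP0] at this
  have hne' : 1 - P z₀ ≠ 0 := by
    rw [← hconj]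
    exact (map_ne_zero _).2 hne
  have hφd := (hPd.const_sub 1).div (hPd.const_add 1) hne
  obtain ⟨m, hm, hmφ⟩ := jack_lemma hφd.differentiableAt
    (by rw [Pi.div_apply, norm_div, ← hconj, Complex.norm_conj, div_self (norm_ne_zero_iff.2 hne)])
    (fun z hz => norm_cayley_root_le hα0 hα1 hq hsec h0 hz) hz₀
  refine ⟨ε, s, m * ((s + s⁻¹) / 2), hε, hspos, le_mul_of_one_le_left (by positivity) hm, ?_, ?_⟩
  · rw [hsα, ← harg, Complex.norm_mul_exp_arg_mul_I]
  · rw [hφd.deriv, Pi.div_apply] at hmφ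
    have hP2 : P z₀ ^ 2 = -(s : ℂ) ^ 2 := by
      rw [hP0]
      linear_combination (s : ℂ) ^ 2 * Complex.I ^ 2 * hε2 + (s : ℂ) ^ 2 * Complex.I_sq
    -- The logarithmic derivative of `(1 - P) / (1 + P)` is `-2 P' / (1 - P²)`, with `P² = -s²` and
    -- `P' / P = q' / (α q)` at `z₀`.
    have hkey : z₀ * deriv q z₀ * (2 * P z₀) = -(m * α * (1 + s ^ 2)) * q z₀ := by
      field_simp at hmφ
      linear_combination (-1) * hmφ + m * α * q z₀ * hP2
    have hεC : (ε : ℂ) ≠ 0 := by rintro h; simp [h] at hε2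
    have hPne : 2 * P z₀ ≠ 0 := by
      rw [hP0]
      simp [hsC, hεC]
    refine mul_right_cancel₀ hPne ?_
    rw [hkey, hP0]
    push_cast
    field_simp
    linear_combination (-(m : ℂ) * (1 + (s : ℂ) ^ 2) * Complex.I ^ 2) * hε2 -
      m * (1 + (s : ℂ) ^ 2) * Complex.I_sq

end Sector

/-! ### Algebra on the boundary rays of the sector -/

theorem exp_sign_mul_I {ε : ℝ} (hε : ε = 1 ∨ ε = -1) (θ : ℝ) :
    Complex.exp (((ε * θ : ℝ) : ℂ) * Complex.I) = ⟨Real.cos θ, ε * Real.sin θ⟩ := by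
  rw [Complex.exp_mul_I, ← Complex.ofReal_cos, ← Complex.ofReal_sin]
  rcases hε with rfl | rfl <;> apply Complex.ext <;>
    simp [-Complex.ofReal_cos, -Complex.ofReal_sin]

theorem exp_sign_complement {ε : ℝ} (hε : ε = 1 ∨ ε = -1) (α : ℝ) :
    Complex.exp (ε * Real.pi * Complex.I * (1 - α) / 2) =
      ⟨Real.sin (Real.pi * α / 2), ε * Real.cos (Real.pi * α / 2)⟩ := by
  have h : (ε * Real.pi * Complex.I * (1 - α) / 2 : ℂ) =
      ((ε * (Real.pi / 2 - Real.pi * α / 2) : ℝ) : ℂ) * Complex.I := by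
    push_cast; ring
  rw [h, exp_sign_mul_I hε, Real.cos_pi_div_two_sub, Real.sin_pi_div_two_sub]

theorem rotatedRe_eq {ε : ℝ} (hε : ε = 1 ∨ ε = -1) (α : ℝ) (u : ℂ) :
    rotatedRe α ε u =
      u.re * Real.cos (Real.pi * α / 2) + u.im * (ε * Real.sin (Real.pi * α / 2)) := by
  have h : (-(ε * Complex.I * Real.pi * α / 2) : ℂ) =
      ((ε * (-(Real.pi * α / 2)) : ℝ) : ℂ) * Complex.I := by
    push_cast; ring
  rw [rotatedRe, h, exp_sign_mul_I hε, Complex.mul_re, Real.cos_neg, Real.sin_neg]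
  ring

theorem normSq_ray_sub_one_add {ε : ℝ} (hε : ε = 1 ∨ ε = -1) (α x : ℝ) (u : ℂ) :
    Complex.normSq (x * Complex.exp (((ε * (Real.pi * α / 2) : ℝ) : ℂ) * Complex.I) - 1 + u) =
      x ^ 2 + 2 * x * (rotatedRe α ε u - Real.cos (Real.pi * α / 2)) +
        (‖u‖ ^ 2 - 2 * u.re + 1) := by
  have hε2 : ε ^ 2 = 1 := by rcases hε with rfl | rfl <;> norm_num
  rw [exp_sign_mul_I hε, rotatedRe_eq hε, ← Complex.normSq_eq_norm_sq, Complex.normSq_apply,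
    Complex.normSq_apply]
  simp only [Complex.add_re, Complex.sub_re, Complex.mul_re, Complex.ofReal_re, Complex.ofReal_im,
    Complex.one_re, Complex.add_im, Complex.sub_im, Complex.mul_im, Complex.one_im]
  linear_combination x ^ 2 * Real.sin_sq_add_cos_sq (Real.pi * α / 2) +
    x ^ 2 * Real.sin (Real.pi * α / 2) ^ 2 * hε2

/-- The cubic `G_ε` on the ray `w + 1 = x e^{ε i π α / 2}`. -/
theorem normSq_sub_normSq_eq_cubicG {ε : ℝ} (hε : ε = 1 ∨ ε = -1) (α x p : ℝ) {a b c w : ℂ}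
    (hp : (p : ℂ) = a + b + 1 - c)
    (hw : w = x * Complex.exp (((ε * (Real.pi * α / 2) : ℝ) : ℂ) * Complex.I) - 1) :
    Complex.normSq ((w + a) * (w + b)) - Complex.normSq (w * (w + (c - 1))) =
      cubicG α p ε a b c x := by
  have hw0 := normSq_ray_sub_one_add hε α x 0
  rw [add_zero, ← hw] at hw0
  rw [map_mul, map_mul, hw0, hw, normSq_ray_sub_one_add hε, normSq_ray_sub_one_add hε,
    normSq_ray_sub_one_add hε]
  -- As `p` is real, the linear data of `c - 1` reduce to those of `a` and `b`; the `x ^ 4` terms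
  -- cancel, leaving a cubic.
  have hc1 : c - 1 = a + b - (p : ℂ) := by rw [hp]; ring
  have hre : (c - 1).re = a.re + b.re - p := by rw [hc1]; simp
  have him : (c - 1).im = a.im + b.im := by rw [hc1]; simp
  have hrot : rotatedRe α ε (c - 1) =
      rotatedRe α ε a + rotatedRe α ε b - p * Real.cos (Real.pi * α / 2) := by
    simp only [rotatedRe_eq hε, hre, him]
    ring
  have hrot0 : rotatedRe α ε 0 = 0 := by simp [rotatedRe]
  rw [hrot, hrot0, hre, cubicG, coeffS, coeffT, coeffU, coeffV]
  simp only [norm_zero, Complex.zero_re]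
  ring

/-- The real part equals `‖u‖ sin (π α / 2 - ε arg u)`, and this angle lies in `(0, π)`. -/
theorem re_mul_exp_complement_pos {α ε : ℝ} (hα1 : α < 1) (hε : ε = 1 ∨ ε = -1)
    {u : ℂ} (hu : u ≠ 0) (harg : |u.arg| < Real.pi * α / 2) :
    0 < (u * Complex.exp (ε * Real.pi * Complex.I * (1 - α) / 2)).re := by
  have hπ := Real.pi_pos
  have hα : Real.pi * α / 2 < Real.pi / 2 := by nlinarith
  have hlt := abs_lt.1 harg
  have hsin : (u * Complex.exp (ε * Real.pi * Complex.I * (1 - α) / 2)).re =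
      ‖u‖ * Real.sin (Real.pi * α / 2 - ε * u.arg) := by
    rw [exp_sign_complement hε, Complex.mul_re, ← Complex.norm_mul_cos_arg u,
      ← Complex.norm_mul_sin_arg u, Real.sin_sub]
    rcases hε with rfl | rfl
    · simp only [one_mul]; ring
    · simp only [neg_one_mul, Real.cos_neg, Real.sin_neg]; ring
  rw [hsin]
  refine mul_pos (norm_pos_iff.2 hu) (Real.sin_pos_of_pos_of_lt_pi ?_ ?_) <;>
    rcases hε with rfl | rfl <;> linarith

/-- The term `p q` contributes nothing: `conj d * p q` is `p |q|²` times an imaginary number,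
because `p` is real. -/
theorem re_conj_mul_ray {ε : ℝ} (hε : ε = 1 ∨ ε = -1) (α k x p : ℝ) {u q d : ℂ}
    (hq : q = x * Complex.exp (((ε * (Real.pi * α / 2) : ℝ) : ℂ) * Complex.I))
    (hd : d = ((ε * α * k : ℝ) : ℂ) * Complex.I * q) :
    (starRingEnd ℂ d * (p * q + u)).re =
      -(α * k * x * (u * Complex.exp (ε * Real.pi * Complex.I * (1 - α) / 2)).re) := by
  have hε2 : ε ^ 2 = 1 := by rcases hε with rfl | rfl <;> norm_num
  rw [exp_sign_mul_I hε] at hq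
  rw [hd, hq, exp_sign_complement hε]
  simp only [Complex.mul_re, Complex.mul_im, Complex.conj_re, Complex.conj_im, Complex.add_re,
    Complex.add_im, Complex.ofReal_re, Complex.ofReal_im, Complex.I_re, Complex.I_im]
  linear_combination (-α * k * x * u.re * Real.sin (Real.pi * α / 2)) * hε2

/-- No boundary value of the sector is compatible with the differential equation in the disk. -/
theorem not_euler_equation_of_cubicG_le {α : ℝ} (hα0 : 0 < α) (hα1 : α < 1) {a b c : ℂ} {p : ℝ}
    (hp : (p : ℂ) = a + b + 1 - c) (hne : a * b - (p : ℂ) ≠ 0)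
    (harg : |Complex.arg (a * b - (p : ℂ))| < Real.pi * α / 2)
    {ε s k : ℝ} (hε : ε = 1 ∨ ε = -1) (hs : 0 < s) (hk : (s + s⁻¹) / 2 ≤ k)
    (hG : cubicG α p ε a b c (s ^ α) ≤ α * (s + s⁻¹) * s ^ α *
      ((a * b - (p : ℂ)) * Complex.exp (ε * Real.pi * Complex.I * (1 - α) / 2)).re)
    {w d z : ℂ}
    (hw : w + 1 =
      ((s ^ α : ℝ) : ℂ) * Complex.exp (((ε * (Real.pi * α / 2) : ℝ) : ℂ) * Complex.I))
    (hd : d = ((ε * α * k : ℝ) : ℂ) * Complex.I * (w + 1)) (hz : ‖z‖ < 1)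
    (h : d + w * (w + (c - 1)) = z * (d + (w + a) * (w + b))) : False := by
  have hR := re_mul_exp_complement_pos hα1 hε hne harg
  have hre := re_conj_mul_ray hε α k (s ^ α) p (u := a * b - (p : ℂ)) hw hd
  have hcub := normSq_sub_normSq_eq_cubicG hε α (s ^ α) p hp (eq_sub_of_add_eq hw)
  set R := ((a * b - (p : ℂ)) * Complex.exp (ε * Real.pi * Complex.I * (1 - α) / 2)).re
  have hx : 0 < s ^ α := Real.rpow_pos_of_pos hs α
  have hkpos : 0 < k := lt_of_lt_of_le (by positivity) hk
  have hD : p * (w + 1) + (a * b - p) = (w + a) * (w + b) - w * (w + (c - 1)) := by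
    rw [hp]; ring
  rw [hD] at hre
  set X := w * (w + (c - 1))
  set Y := (w + a) * (w + b)
  have hexp : Complex.normSq (d + Y) - Complex.normSq (d + X) =
      2 * (starRingEnd ℂ d * (Y - X)).re + (Complex.normSq Y - Complex.normSq X) := by
    simp only [Complex.normSq_apply, Complex.mul_re, Complex.conj_re, Complex.conj_im,
      Complex.add_re, Complex.add_im, Complex.sub_re, Complex.sub_im]
    ring
  have hle : Complex.normSq (d + Y) ≤ Complex.normSq (d + X) := by
    have : α * (s + s⁻¹) * s ^ α * R ≤ 2 * (α * k * s ^ α * R) := by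
      have := mul_le_mul_of_nonneg_left hk (by positivity : 0 ≤ 2 * (α * s ^ α * R))
      linarith
    rw [← sub_nonpos, hexp, hre, hcub]
    linarith
  -- Otherwise `|d + X| = |z| |d + Y| < |d + Y|`, against `hle`.
  have hY : d + Y = 0 := by
    by_contra hY
    rw [h, map_mul, Complex.normSq_eq_norm_sq z] at hle
    have h1 := Complex.normSq_pos.2 hY
    have h2 : ‖z‖ ^ 2 < 1 := pow_lt_one₀ (norm_nonneg z) hz two_ne_zero
    nlinarith
  have hX : d + X = 0 := by rw [h, hY, mul_zero]
  have hYX : Y - X = 0 := by linear_combination hY - hX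
  rw [hYX, mul_zero, Complex.zero_re] at hre
  have : 0 < α * k * s ^ α * R := by positivity
  linarith

/-! ### The first exit point and the conclusion -/

/-- If `Re (z f' / f) ≥ 0` for `f = z F`, then `f` is nonzero at the end of a radius. -/
theorem ne_zero_of_radial_re_nonneg {F : ℂ → ℂ} (hF : DifferentiableOn ℂ F (ball 0 1)) {z₀ : ℂ}
    (hz₀ : z₀ ∈ ball (0 : ℂ) 1) (hne0 : z₀ ≠ 0)
    (h : ∀ z ∈ ball (0 : ℂ) ‖z₀‖, F z ≠ 0 ∧ 0 ≤ (1 + z * deriv F z / F z).re) : F z₀ ≠ 0 := by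
  have hpos := norm_pos_iff.2 hne0
  have hz1 : ‖z₀‖ < 1 := mem_ball_zero_iff.1 hz₀
  have hder : ∀ t ∈ Set.Icc (1 / 2 : ℝ) 1, HasDerivAt (fun t : ℝ => (t : ℂ) * F (t * z₀))
      (1 * F (t * z₀) + t * (deriv F (t * z₀) * (1 * z₀))) t := by
    intro t ht
    have hmem : (t : ℂ) * z₀ ∈ ball (0 : ℂ) 1 := by
      rw [mem_ball_zero_iff, norm_mul, Complex.norm_of_nonneg (by linarith [ht.1])]
      nlinarith [ht.2]
    have h1 := (Complex.ofRealCLM.hasDerivAt (x := t)).mul_const z₀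
    have h2 := (hF.differentiableAt (isOpen_ball.mem_nhds hmem)).hasDerivAt
    have h3 := HasDerivAt.comp t (h := fun t : ℝ => (t : ℂ) * z₀) h2 h1
    exact (Complex.ofRealCLM.hasDerivAt (x := t)).mul h3
  -- The derivative of `|t F(t z₀)|²` is `2 t |F|² Re (1 + z F' / F) ≥ 0` at `z = t z₀`. Starting at
  -- `t = 1 / 2` makes the initial value positive.
  have hmono : MonotoneOn (fun t : ℝ => ‖(t : ℂ) * F (t * z₀)‖ ^ 2) (Set.Icc (1 / 2) 1) := by
    refine monotoneOn_of_deriv_nonneg (convex_Icc _ _)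
      (fun t ht => (hder t ht).norm_sq.continuousAt.continuousWithinAt)
      (fun t ht => ((hder t (interior_subset ht)).norm_sq.differentiableAt).differentiableWithinAt)
      fun t ht => ?_
    rw [(hder t (interior_subset ht)).norm_sq.deriv]
    rw [interior_Icc] at ht
    have ht0 : 0 < t := by linarith [ht.1]
    obtain ⟨hFne, hre⟩ := h (t * z₀) (by
      rw [mem_ball_zero_iff, norm_mul, Complex.norm_of_nonneg ht0.le]
      nlinarith [ht.2])
    have hrw : (1 * F (t * z₀) + t * (deriv F (t * z₀) * (1 * z₀))) *
        starRingEnd ℂ (t * F (t * z₀)) =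
        ((t * Complex.normSq (F (t * z₀)) : ℝ) : ℂ) *
          (1 + t * z₀ * deriv F (t * z₀) / F (t * z₀)) := by
      rw [map_mul, Complex.conj_ofReal, Complex.ofReal_mul, Complex.normSq_eq_conj_mul_self]
      field_simp
    rw [Complex.inner, hrw, Complex.re_ofReal_mul]
    have := Complex.normSq_nonneg (F (t * z₀))
    positivity
  have hle := hmono (Set.left_mem_Icc.2 (by norm_num)) (Set.right_mem_Icc.2 (by norm_num))
    (by norm_num : (1 / 2 : ℝ) ≤ 1)
  have hhalf : F (((1 / 2 : ℝ) : ℂ) * z₀) ≠ 0 := by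
    refine (h _ ?_).1
    rw [mem_ball_zero_iff, norm_mul, Complex.norm_of_nonneg (by norm_num)]
    linarith
  intro hzero
  simp only [Complex.ofReal_one, one_mul, hzero, norm_zero] at hle
  have : 0 < ‖((1 / 2 : ℝ) : ℂ) * F (((1 / 2 : ℝ) : ℂ) * z₀)‖ :=
    norm_pos_iff.2 (mul_ne_zero (by norm_num) hhalf)
  nlinarith

/-- An open condition on the unit disk that fails somewhere fails at a point of least modulus. -/
theorem exists_notMem_of_norm_lt {U : Set ℂ} (hU : IsOpen U) {z₁ : ℂ} (hz₁ : z₁ ∉ U) :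
    ∃ z₀ ∉ U, ‖z₀‖ ≤ ‖z₁‖ ∧ ball 0 ‖z₀‖ ⊆ U := by
  have hK : IsCompact (closedBall (0 : ℂ) ‖z₁‖ \ U) := (isCompact_closedBall _ _).diff hU
  obtain ⟨z₀, hz₀, hmin⟩ := hK.exists_isMinOn ⟨z₁, by simp, hz₁⟩ continuous_norm.continuousOn
  have hz₀' := mem_closedBall_zero_iff.1 hz₀.1
  refine ⟨z₀, hz₀.2, hz₀', fun y hy => ?_⟩
  by_contra hyU
  have hylt := mem_ball_zero_iff.1 hy
  exact absurd (hmin ⟨mem_closedBall_zero_iff.2 (hylt.le.trans hz₀'), hyU⟩) (not_le.2 hylt)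

theorem mainTheorem7 (α : ℝ) (hα0 : 0 < α) (hα1 : α < 1) (a b c : ℂ)
    (hab : a * b ≠ 0) (hc : ∀ n : ℕ, c ≠ -(n : ℂ))
    (p : ℝ) (hp : (p : ℂ) = a + b + 1 - c)
    (hne : a * b - (p : ℂ) ≠ 0)
    (harg : |Complex.arg (a * b - (p : ℂ))| < Real.pi * α / 2)
    (hG : ∀ s : ℝ, 0 < s → ∀ ε : ℝ, ε = 1 ∨ ε = -1 →
      cubicG α p ε a b c (s ^ α) ≤
        α * (s + s⁻¹) * s ^ α *
          ((a * b - (p : ℂ)) * Complex.exp (ε * Real.pi * Complex.I * (1 - α) / 2)).re) :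
    IsStronglyStarlike α (shiftedHypergeometric a b c) := by
  have hπ := Real.pi_pos
  have hcos := cos_pi_mul_div_two_pos hα0 hα1
  obtain ⟨F, hF⟩ : ∃ F : ℂ → ℂ, F = ordinaryHypergeometric a b c := ⟨_, rfl⟩
  have hFd : DifferentiableOn ℂ F (ball 0 1) := hF ▸ differentiableOn_ordinaryHypergeometric hc
  have hF0 : F 0 = 1 := by rw [hF, ordinaryHypergeometric_zero]
  set G : ℂ → ℂ := fun z => z * deriv F z with hGdef
  have hGd : DifferentiableOn ℂ G (ball 0 1) := differentiableOn_id.mul (hFd.deriv isOpen_ball)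
  set q : ℂ → ℂ := fun z => 1 + G z / F z with hqdef
  have hFat : ∀ z ∈ ball (0 : ℂ) 1, HasDerivAt F (deriv F z) z := fun z hz =>
    (hFd.differentiableAt (isOpen_ball.mem_nhds hz)).hasDerivAt
  have hqd : ∀ z ∈ ball (0 : ℂ) 1, F z ≠ 0 →
      HasDerivAt q ((deriv G z * F z - G z * deriv F z) / F z ^ 2) z := fun z hz hFz =>
    ((hGd.differentiableAt (isOpen_ball.mem_nhds hz)).hasDerivAt.div (hFat z hz) hFz).const_add 1
  -- The condition `F z ≠ 0` is needed: division by zero would give `q z = 1`, inside the sector.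
  set U : Set ℂ :=
    {z | z ∈ ball (0 : ℂ) 1 ∧ F z ≠ 0 ∧ ‖q z‖ * Real.cos (Real.pi * α / 2) < (q z).re}
  have hU : IsOpen U := by
    refine isOpen_iff_mem_nhds.2 fun z ⟨hz, hFz, hqz⟩ => ?_
    have hqc := (hqd z hz hFz).continuousAt
    filter_upwards [isOpen_ball.mem_nhds hz, (hFat z hz).continuousAt.eventually_ne hFz,
      (hqc.norm.mul continuousAt_const).eventually_lt
        (Complex.continuous_re.continuousAt.comp hqc) hqz] with y h1 h2 h3
    exact ⟨h1, h2, h3⟩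
  have hq0 : q 0 = 1 := by simp [hqdef, hGdef]
  have h0U : (0 : ℂ) ∈ U := by
    refine ⟨by simp, by simp [hF0], ?_⟩
    rw [hq0, norm_one, one_mul, Complex.one_re, ← Real.cos_zero]
    exact Real.cos_lt_cos_of_nonneg_of_le_pi le_rfl (by nlinarith) (by positivity)
  have hall : ball (0 : ℂ) 1 ⊆ U := by
    intro z₁ hz₁
    by_contra hz₁U
    obtain ⟨z₀, hz₀U, hz₀le, hsub⟩ := exists_notMem_of_norm_lt hU hz₁U
    have hz₀lt : ‖z₀‖ < 1 := hz₀le.trans_lt (mem_ball_zero_iff.1 hz₁)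
    have hz₀ : z₀ ∈ ball (0 : ℂ) 1 := mem_ball_zero_iff.2 hz₀lt
    have hz₀0 : z₀ ≠ 0 := by rintro rfl; exact hz₀U h0U
    have hFz₀ : F z₀ ≠ 0 := ne_zero_of_radial_re_nonneg hFd hz₀ hz₀0 fun z hz =>
      ⟨(hsub hz).2.1, (mul_nonneg (norm_nonneg _) hcos.le).trans (hsub hz).2.2.le⟩
    have hqz₀ := hqd z₀ hz₀ hFz₀
    -- One inequality holds because `z₀` is not in `U`, the other by continuity from the open disk,
    -- where `q` stays in the sector.
    have heq : ‖q z₀‖ * Real.cos (Real.pi * α / 2) = (q z₀).re := by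
      refine le_antisymm ?_ (not_lt.1 fun hlt => hz₀U ⟨hz₀, hFz₀, hlt⟩)
      have hcl : z₀ ∈ closure (ball (0 : ℂ) ‖z₀‖) := by
        rw [closure_ball _ (norm_ne_zero_iff.2 hz₀0)]; simp
      exact ContinuousWithinAt.closure_le hcl
        (hqz₀.continuousAt.norm.mul continuousAt_const).continuousWithinAt
        (Complex.continuous_re.continuousAt.comp hqz₀.continuousAt).continuousWithinAt
        fun y hy => (hsub hy).2.2.le
    obtain ⟨ε, s, k, hε, hs, hk, hqv, hqder⟩ := exists_of_norm_mul_cos_eq_re hα0 hα1 hz₀0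
      (fun z hz => (hqd z (hsub hz).1 (hsub hz).2.1).differentiableAt.differentiableWithinAt)
      hqz₀.differentiableAt hq0 (fun z hz => (hsub hz).2.2) heq
    have hode := ordinaryHypergeometric_euler_equation (a := a) (b := b) hc hF
      (fun z => (rfl : G z = z * deriv F z)) hz₀
    have hw1 : G z₀ / F z₀ + 1 = q z₀ := add_comm _ _
    refine not_euler_equation_of_cubicG_le hα0 hα1 hp hne harg hε hs hk (hG s hs ε hε)
      (w := G z₀ / F z₀) (d := z₀ * deriv q z₀) (hw1.trans hqv) (by rw [hw1, hqder]) hz₀lt ?_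
    -- With `w = G / F`, `z w' = z G' / F - w²`; substituting this in Gauss's equation divided by
    -- `F` gives the Riccati equation.
    have hd : z₀ * deriv q z₀ = z₀ * deriv G z₀ / F z₀ - (G z₀ / F z₀) ^ 2 := by
      rw [hqz₀.deriv]
      have : G z₀ = z₀ * deriv F z₀ := rfl
      field_simp
      rw [this]
      ring
    rw [hd]
    field_simp
    linear_combination F z₀ * hode
  have hf : shiftedHypergeometric a b c = fun z => z * F z := by
    funext z; rw [shiftedHypergeometric, hF]
  have hfd : ∀ z ∈ ball (0 : ℂ) 1, HasDerivAt (fun z => z * F z) (F z * q z) z := by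
    intro z hz
    have hFz := (hall hz).2.1
    have h := (hasDerivAt_id z).mul (hFat z hz)
    have he : F z * q z = 1 * F z + id z * deriv F z := by
      simp only [hqdef, hGdef, id]
      field_simp
    rw [he]
    exact h
  have hqne : ∀ z ∈ ball (0 : ℂ) 1, q z ≠ 0 := by
    intro z hz h
    have := (hall hz).2.2
    simp [h] at this
  rw [hf]
  refine ⟨fun z hz => (hfd z hz).differentiableAt.differentiableWithinAt, by simp, ?_,
    fun z hz hz0 => mul_ne_zero hz0 (hall hz).2.1, fun z hz _ => ?_, fun z hz hz0 => ?_⟩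
  · rw [(hfd 0 (by simp)).deriv, hF0, hq0, one_mul]
  · rw [(hfd z hz).deriv]
    exact mul_ne_zero (hall hz).2.1 (hqne z hz)
  · have hFz := (hall hz).2.1
    rw [(hfd z hz).deriv, ← mul_assoc, mul_div_cancel_left₀ _ (mul_ne_zero hz0 hFz)]
    exact (norm_mul_cos_lt_re_iff (by positivity) (by nlinarith) (hqne z hz)).1 (hall hz).2.2
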